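/- For an undirected capacitated graph $G=(V,E,c)$ with non-negative capacities and a set $K\subseteq V$ of $k$ terminals, let $h(A)$ be the total capacity of the edges between $A$ and $V\setminus A$ ($A\subseteq V$), and for $U\subseteq K$ let $h_K(U)=\min\{h(A): A\subseteq V,\ A\cap K=U\}$. A cut-sparsifier for $(G,K)$ is a capacitated graph $H$ with vertex set $K$ whose cut function $h'$ satisfies $h_K(U)\le h'(U)$ for all $U\subseteq K$; its quality is $\max_{U\subseteq K} h'(U)/h_K(U)$, where $0/0=1$ (and $a/0=\infty$ for $a>0$). For $d\ge 0$ let $G_d$ be the graph consisting of the $d$-dimensional hypercube on the nodes $y_s$, $s\in\{0,1\}^d$, with all edges of capacity $1$, together with one further vertex $z_s$ for each $s$, joined only to $y_s$, by an edge of capacity $\sqrt d$. Let the terminal set be $K_d=\{z_s : s\in\{0,1\}^d\}$, so that $k=|K_d|=2^d$ and $d=\log_2 k$. Theorem. No cut-sparsifier for $(G_d,K_d)$ has quality better than $\Omega(\log^{1/4}k)$: there is an absolute constant $c>0$ such that for every $d$, every cut-sparsifier $H$ for $(G_d,K_d)$ has quality strictly greater than $c\,(\log_2 k)^{1/4}$.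 -/

import Mathlib

open scoped NNReal ENNReal

/-- An undirected capacitated graph on the vertex set `V`, given by its symmetric capacity
function. Vertices `u`, `v` are joined by an edge iff `cap u v ≠ 0`; parallel edges are merged by
adding capacities. Loops contribute to no cut. -/
structure CapGraph (V : Type*) where
  cap : V → V → ℝ≥0
  cap_symm : ∀ u v, cap u v = cap v u

namespace CapGraph

variable {V : Type*} [Fintype V] [DecidableEq V]

/-- The cut function `h(A)`: the total capacity of the edges between `A` and `V - A`. -/
def cut (G : CapGraph V) (A : Finset V) : ℝ≥0 :=
  ∑ u ∈ A, ∑ v ∈ Aᶜ, G.cap u v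

/-- The vertex sets `A ⊆ V` with `A ∩ K = U`. -/
def extensions (K : Finset V) (U : Finset K) : Finset (Finset V) :=
  Finset.univ.filter fun A => A ∩ K = U.map (Function.Embedding.subtype _)

theorem extensions_nonempty (K : Finset V) (U : Finset K) : (extensions K U).Nonempty := by
  refine ⟨U.map (Function.Embedding.subtype _), ?_⟩
  simp only [extensions, Finset.mem_filter, Finset.mem_univ, true_and, Finset.inter_eq_left]
  intro x hx
  obtain ⟨y, -, rfl⟩ := Finset.mem_map.mp hx
  exact y.2

/-- The terminal cut function `h_K(U) = min {h(A) : A ⊆ V, A ∩ K = U}`. -/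
noncomputable def terminalCut (G : CapGraph V) (K : Finset V) (U : Finset K) : ℝ≥0 :=
  (extensions K U).inf' (extensions_nonempty K U) G.cut

/-- `H`, a graph on just the terminals `K`, is a cut-sparsifier for `G` and `K`. -/
def IsCutSparsifier (G : CapGraph V) (K : Finset V) (H : CapGraph K) : Prop :=
  ∀ U : Finset K, G.terminalCut K U ≤ H.cut U

/-- The ratio `a / b`, with `0 / 0 = 1` and `a / 0 = ∞` for `a > 0`. -/
noncomputable def cutRatio (a b : ℝ≥0) : ℝ≥0∞ :=
  if a = 0 ∧ b = 0 then 1 else (a : ℝ≥0∞) / (b : ℝ≥0∞)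

/-- The quality of `H`: the maximum over all `U ⊆ K` of `h'(U) / h_K(U)`. -/
noncomputable def quality (G : CapGraph V) (K : Finset V) (H : CapGraph K) : ℝ≥0∞ :=
  ⨆ U : Finset K, cutRatio (H.cut U) (G.terminalCut K U)

end CapGraph

/-- The vertices `{0,1}^d` of the `d`-dimensional hypercube. -/
abbrev Cube (d : ℕ) : Type := Fin d → Bool

/-- Capacities of the hypercube with pendant terminals: `Sum.inl s` is the hypercube node `y_s`
and `Sum.inr s` is the terminal `z_s`. -/
noncomputable def pendantCubeCap (d : ℕ) : Cube d ⊕ Cube d → Cube d ⊕ Cube d → ℝ≥0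
  | Sum.inl s, Sum.inl t => if hammingDist s t = 1 then 1 else 0
  | Sum.inl s, Sum.inr t => if s = t then NNReal.sqrt d else 0
  | Sum.inr s, Sum.inl t => if s = t then NNReal.sqrt d else 0
  | Sum.inr _, Sum.inr _ => 0

/-- The `d`-dimensional hypercube with unit-capacity edges, and a pendant terminal attached to
each of its nodes by an edge of capacity `√d`. -/
noncomputable def pendantCube (d : ℕ) : CapGraph (Cube d ⊕ Cube d) where
  cap := pendantCubeCap d
  cap_symm := by
    rintro (s | s) (t | t) <;> simp [pendantCubeCap, hammingDist_comm, eq_comm]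

/-- The set of the `k = 2 ^ d` pendant terminals `z_s`. -/
def cubeTerminals (d : ℕ) : Finset (Cube d ⊕ Cube d) :=
  Finset.univ.map Function.Embedding.inr

open Finset

/-! ### Cuts and quality in general capacitated graphs. -/

namespace CapGraph

variable {V : Type*} [DecidableEq V]

/-! Average over the halfspaces `form ε x > θ`, with random signs `ε` and integer thresholds `θ`
from 0 to about `√d / 16`. A halfspace is expensive in the pendant cube: a set `B` either disagrees
with it on a constant fraction of the nodes, each costing `√d`, or correlates with `form ε` strongly
enough to have edge boundary of order `2 ^ d * √d` (`le_terminalCut_halfspace`).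

A sparsifier of quality `q` is limited by cheap cuts: singletons bound its total capacity by `2 ^ d
* q * √d`, and subcubes bound its capacity weighted by Hamming distance by `2 ^ d * 2 * q * d`
(`sum_cap_le`, `sum_cap_mul_hammingDist_le`). At most `|form ε x - form ε y|` thresholds separate
`x` from `y`, which averages to at most twice the square root of their Hamming distance. AM-GM with
parameter `τ` linearises this root (`sum_cut_halfspace_le`). Taking `τ = d ^ (1/4)`, the halfspace
cuts of the sparsifier sum on average to `O(2 ^ d * q * d ^ (3/4))`, but must reach order `2 ^ d *
d`; hence `q` is at least of order `d ^ (1/4)`. -/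

/-- The indicator that `A` contains `x` but not `y`. -/
def sep (A : Finset V) (x y : V) : ℝ := if x ∈ A ∧ y ∉ A then 1 else 0

theorem sep_nonneg (A : Finset V) (x y : V) : 0 ≤ sep A x y := by
  unfold sep; split_ifs <;> norm_num

variable [Fintype V]

theorem coe_cut (G : CapGraph V) (A : Finset V) :
    (G.cut A : ℝ) = ∑ u, ∑ v, (G.cap u v : ℝ) * sep A u v := by
  have h1 : ∀ u, ∑ v, (G.cap u v : ℝ) * sep A u v =
      if u ∈ A then ∑ v ∈ Aᶜ, (G.cap u v : ℝ) else 0 := by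
    intro u
    by_cases hu : u ∈ A
    · simp only [sep, hu, true_and, if_true, mul_ite, mul_one, mul_zero]
      rw [← Finset.sum_filter]
      congr 1
      ext v; simp
    · simp [sep, hu]
  simp_rw [h1, ← Finset.sum_filter]
  simp [cut]

theorem terminalCut_le (G : CapGraph V) {K : Finset V} {U : Finset K} {A : Finset V}
    (hA : A ∈ extensions K U) : G.terminalCut K U ≤ G.cut A :=
  Finset.inf'_le _ hA

/-- The empty set has ratio `0 / 0 = 1`. This settles the case `d = 0`. -/
theorem one_le_quality (G : CapGraph V) (K : Finset V) (H : CapGraph K) :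
    1 ≤ G.quality K H := by
  have h : G.terminalCut K ∅ = 0 := by
    refine le_antisymm ((G.terminalCut_le (A := ∅) ?_).trans ?_) zero_le
    · rw [extensions, Finset.mem_filter]; simp
    · simp [cut]
  calc (1 : ℝ≥0∞) = cutRatio (H.cut ∅) (G.terminalCut K ∅) := by
        simp [cutRatio, h, cut]
    _ ≤ _ := le_iSup (fun U : Finset K => cutRatio (H.cut U) (G.terminalCut K U)) ∅

theorem cut_le_of_quality_le (G : CapGraph V) (K : Finset V) (H : CapGraph K) {q : ℝ}
    (hq : 0 ≤ q) (h : G.quality K H ≤ ENNReal.ofReal q) (U : Finset K) :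
    (H.cut U : ℝ) ≤ q * G.terminalCut K U := by
  have h1 : cutRatio (H.cut U) (G.terminalCut K U) ≤ ENNReal.ofReal q :=
    (le_iSup (fun U : Finset K => cutRatio (H.cut U) (G.terminalCut K U)) U).trans h
  by_cases h0 : H.cut U = 0 ∧ G.terminalCut K U = 0
  · simp [h0.1, h0.2]
  · rw [cutRatio, if_neg h0] at h1
    by_cases hb : G.terminalCut K U = 0
    · have ha : H.cut U ≠ 0 := fun ha => h0 ⟨ha, hb⟩
      rw [hb, ENNReal.coe_zero, ENNReal.div_zero (by simpa using ha)] at h1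
      simp at h1
    · rw [ENNReal.div_le_iff (by simpa using hb) (by simp), ENNReal.ofReal,
        ← ENNReal.coe_mul, ENNReal.coe_le_coe] at h1
      have h2 : (H.cut U : ℝ) ≤ (q.toNNReal * G.terminalCut K U : ℝ≥0) := by exact_mod_cast h1
      simpa [Real.coe_toNNReal q hq] using h2

end CapGraph

open CapGraph

namespace PendantCube

variable {d : ℕ}

/-! ### Bit flips and moments of Rademacher sums. -/

/-- The sign `±1` of a bit. -/
def sgn (b : Bool) : ℤ := if b then 1 else -1

@[simp] theorem sgn_mul_self (b : Bool) : sgn b * sgn b = 1 := by cases b <;> rfl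

@[simp] theorem sgn_not (b : Bool) : sgn (!b) = -sgn b := by cases b <;> rfl

/-- The cube node obtained by flipping the `i`-th bit. -/
def flip (i : Fin d) (x : Cube d) : Cube d := Function.update x i (!x i)

@[simp] theorem flip_self (i : Fin d) (x : Cube d) : flip i x i = !x i := by simp [flip]

theorem flip_ne {i j : Fin d} (h : j ≠ i) (x : Cube d) : flip i x j = x j := by simp [flip, h]

theorem flip_involutive (i : Fin d) : Function.Involutive (flip i) := by
  intro x; ext j
  by_cases h : j = i
  · subst h; simp
  · simp [flip_ne h]

theorem sum_flip {M : Type*} [AddCommMonoid M] (i : Fin d) (f : Cube d → M) :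
    ∑ x, f (flip i x) = ∑ x, f x :=
  Equiv.sum_comp (flip_involutive i).toPerm f

theorem flip_injective (x : Cube d) : Function.Injective fun i => flip i x := by
  intro i j h
  by_contra hij
  have := congrFun h i
  simp [flip_ne hij] at this

theorem hammingDist_eq_sum (x y : Cube d) :
    hammingDist x y = ∑ i, if x i ≠ y i then 1 else 0 := by
  simp only [hammingDist, Finset.card_filter]

theorem hammingDist_flip (i : Fin d) (x : Cube d) : hammingDist x (flip i x) = 1 := by
  rw [hammingDist_eq_sum, Finset.sum_eq_single i]
  · simp
  · intro j _ hj; simp [flip_ne hj]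
  · simp

theorem sum_mul_sgn_eq_zero (j : Fin d) (g : Cube d → ℤ) (hg : ∀ x, g (flip j x) = g x) :
    ∑ x, g x * sgn (x j) = 0 := by
  have h := sum_flip j fun x => g x * sgn (x j)
  simp only [hg, flip_self, sgn_not, mul_neg, Finset.sum_neg_distrib] at h
  omega

/-- The Rademacher sum with coefficients `a`, over the index set `s`. -/
def partialForm (a : Fin d → ℤ) (s : Finset (Fin d)) (x : Cube d) : ℤ :=
  ∑ i ∈ s, a i * sgn (x i)

theorem partialForm_flip (a : Fin d → ℤ) {s : Finset (Fin d)} {j : Fin d} (hj : j ∉ s)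
    (x : Cube d) : partialForm a s (flip j x) = partialForm a s x :=
  Finset.sum_congr rfl fun i hi => by
    rw [flip_ne (by rintro rfl; exact hj hi)]

theorem sum_partialForm_sq (a : Fin d → ℤ) (s : Finset (Fin d)) :
    ∑ x, partialForm a s x ^ 2 = 2 ^ d * ∑ i ∈ s, a i ^ 2 := by
  induction s using Finset.induction_on with
  | empty => simp [partialForm]
  | insert j s hj ih =>
    have h1 := sum_mul_sgn_eq_zero j (fun x => 2 * a j * partialForm a s x)
      fun x => by rw [partialForm_flip a hj]
    have h2 : ∀ x, partialForm a (insert j s) x ^ 2 =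
        partialForm a s x ^ 2 + 2 * a j * partialForm a s x * sgn (x j) + a j ^ 2 := by
      intro x
      have h3 := sgn_mul_self (x j)
      simp only [partialForm, Finset.sum_insert hj] at *
      linear_combination a j ^ 2 * h3
    simp only [h2, Finset.sum_add_distrib, h1, ih, Finset.sum_insert hj]
    simp
    ring

/-- When a coordinate is added, the terms odd in its sign cancel under the flip; the rest is
absorbed by `3 * (S + a j ^ 2) ^ 2`, where `S` is the old sum of squares. -/
theorem sum_partialForm_pow_four_le (a : Fin d → ℤ) (s : Finset (Fin d)) :
    ∑ x, partialForm a s x ^ 4 ≤ 2 ^ d * (3 * (∑ i ∈ s, a i ^ 2) ^ 2) := by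
  induction s using Finset.induction_on with
  | empty => simp [partialForm]
  | insert j s hj ih =>
    have h1 := sum_mul_sgn_eq_zero j
      (fun x => 4 * a j * partialForm a s x ^ 3 + 4 * a j ^ 3 * partialForm a s x)
      fun x => by rw [partialForm_flip a hj]
    have h2 : ∀ x, partialForm a (insert j s) x ^ 4 =
        partialForm a s x ^ 4 + (4 * a j * partialForm a s x ^ 3 +
          4 * a j ^ 3 * partialForm a s x) * sgn (x j) +
          6 * a j ^ 2 * partialForm a s x ^ 2 + a j ^ 4 := by
      intro x
      have h3 := sgn_mul_self (x j)
      simp only [partialForm, Finset.sum_insert hj] at *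
      generalize ∑ i ∈ s, a i * sgn (x i) = P at *
      linear_combination (6 * a j ^ 2 * P ^ 2 + 4 * a j ^ 3 * P * sgn (x j) +
        a j ^ 4 * (sgn (x j) ^ 2 + 1)) * h3
    simp only [h2, Finset.sum_add_distrib, h1, Finset.sum_insert hj, ← Finset.mul_sum,
      sum_partialForm_sq]
    simp only [Finset.sum_const, Finset.card_univ, Fintype.card_fun, Fintype.card_bool,
      Fintype.card_fin, nsmul_eq_mul, Nat.cast_pow, Nat.cast_ofNat]
    have h4 : (0 : ℤ) ≤ 2 ^ d * a j ^ 4 := by positivity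
    nlinarith

/-- The linear form `∑ i, ε i * x i` in the `±1` coordinates of `ε` and `x`. -/
def form (ε x : Cube d) : ℤ := partialForm (fun i => sgn (ε i)) Finset.univ x

theorem sum_form_sq (ε : Cube d) : ∑ x, (form ε x : ℝ) ^ 2 = 2 ^ d * d := by
  have h := sum_partialForm_sq (fun i => sgn (ε i)) Finset.univ
  simp only [sq (sgn _), sgn_mul_self, Finset.sum_const, Finset.card_univ, Fintype.card_fin,
    nsmul_eq_mul, mul_one] at h
  exact_mod_cast h

theorem sum_form_pow_four_le (ε : Cube d) :
    ∑ x, (form ε x : ℝ) ^ 4 ≤ 2 ^ d * (3 * (d : ℝ) ^ 2) := by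
  have h := sum_partialForm_pow_four_le (fun i => sgn (ε i)) Finset.univ
  simp only [sq (sgn _), sgn_mul_self, Finset.sum_const, Finset.card_univ, Fintype.card_fin,
    nsmul_eq_mul, mul_one] at h
  exact_mod_cast h

/-- For fixed `x` and `y` the difference is itself a Rademacher sum in `ε`, with coefficients 0 or
`±2`. -/
theorem sum_form_sub_sq (x y : Cube d) :
    ∑ ε : Cube d, ((form ε x : ℝ) - form ε y) ^ 2 = 2 ^ d * (4 * hammingDist x y) := by
  have h := sum_partialForm_sq (fun i => sgn (x i) - sgn (y i)) Finset.univ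
  have h1 : ∀ ε : Cube d, partialForm (fun i => sgn (x i) - sgn (y i)) Finset.univ ε =
      form ε x - form ε y := by
    intro ε
    simp only [form, partialForm, ← Finset.sum_sub_distrib]
    exact Finset.sum_congr rfl fun i _ => by ring
  have h2 : ∀ i, (sgn (x i) - sgn (y i)) ^ 2 = 4 * if x i ≠ y i then 1 else 0 := by
    intro i
    cases x i <;> cases y i <;> simp [sgn]
  simp only [h1, h2, ← Finset.mul_sum] at h
  rw [hammingDist_eq_sum]
  exact_mod_cast h

/-- A Khintchine bound: `|u|` dominates a combination of `u ^ 2` and `u ^ 4`, so the second and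
fourth moments suffice. -/
theorem le_sum_abs_form (ε : Cube d) :
    2 ^ d * (√d / 2) ≤ ∑ x, |(form ε x : ℝ)| := by
  rcases Nat.eq_zero_or_pos d with rfl | hd
  · simp
  set r : ℝ := √d with hr
  have hr0 : 0 < r := by positivity
  have hrr : r ^ 2 = d := Real.sq_sqrt (by positivity)
  have key : ∀ u : ℝ, 3 / 4 * (u ^ 2 * r ^ 2 - u ^ 4 / 9) ≤ r ^ 3 * |u| := by
    intro u
    have h0 := abs_nonneg u
    rw [← sq_abs u, show u ^ 4 = |u| ^ 4 by rw [pow_abs, abs_of_nonneg]; positivity]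
    generalize |u| = v at *
    -- `v * r ^ 2 - v ^ 3 / 9` is maximal at `v = √3 * r`; 7/4 approximates `√3`, and 7/2 removes
    -- the quadratic term.
    have h1 : 0 ≤ (v - 7 / 4 * r) ^ 2 * (v + 7 / 2 * r) := by positivity
    have h4 : 0 ≤ v ^ 3 := by positivity
    have h2 : 0 ≤ r ^ 3 := by positivity
    have h3 : v * r ^ 2 - v ^ 3 / 9 ≤ 4 / 3 * r ^ 3 := by nlinarith
    nlinarith [mul_le_mul_of_nonneg_left h3 h0]
  have h1 : ∑ x, 3 / 4 * ((form ε x : ℝ) ^ 2 * r ^ 2 - (form ε x : ℝ) ^ 4 / 9) ≤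
      ∑ x, r ^ 3 * |(form ε x : ℝ)| := Finset.sum_le_sum fun x _ => key _
  rw [← Finset.mul_sum, ← Finset.mul_sum, Finset.sum_sub_distrib, ← Finset.sum_mul,
    ← Finset.sum_div, sum_form_sq] at h1
  have h2 := sum_form_pow_four_le ε
  rw [← hrr] at h1 h2
  have h3 : r ^ 3 * (2 ^ d * (r / 2)) ≤ r ^ 3 * ∑ x, |(form ε x : ℝ)| := by
    nlinarith
  exact le_of_mul_le_mul_left h3 (by positivity)

/-! ### Halfspaces are expensive to cut off. -/

/-- The halfspace of all `x` with `θ < ∑ i, ε i * x i`. -/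
def halfspace (ε : Cube d) (θ : ℕ) : Finset (Cube d) :=
  Finset.univ.filter fun x => (θ : ℤ) < form ε x

theorem sum_sep_halfspace_le (ε x y : Cube d) (m : ℕ) :
    ∑ θ ∈ Finset.range m, sep (halfspace ε θ) x y ≤ |(form ε x : ℝ) - form ε y| := by
  have h1 : ∑ θ ∈ Finset.range m, sep (halfspace ε θ) x y =
      (((Finset.range m).filter fun θ : ℕ => (θ : ℤ) < form ε x ∧ ¬ (θ : ℤ) < form ε y).card :
        ℝ) := by
    simp [sep, halfspace]
  have h2 : ((Finset.range m).filter
      fun θ : ℕ => (θ : ℤ) < form ε x ∧ ¬ (θ : ℤ) < form ε y).card ≤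
      (Finset.Ico (form ε y) (form ε x)).card := by
    refine Finset.card_le_card_of_injOn (fun θ : ℕ => (θ : ℤ)) ?_ (by intro a _ b _; simp)
    intro θ hθ
    simp at hθ ⊢
    omega
  rw [Int.card_Ico] at h2
  have h3 : ((form ε x - form ε y).toNat : ℤ) ≤ |form ε x - form ε y| := by
    rw [Int.toNat_eq_max]
    exact max_le (le_abs_self _) (abs_nonneg _)
  rw [h1]
  have h4 : ((((Finset.range m).filter
      fun θ : ℕ => (θ : ℤ) < form ε x ∧ ¬ (θ : ℤ) < form ε y).card : ℤ)) ≤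
      |form ε x - form ε y| := le_trans (by exact_mod_cast h2) h3
  exact_mod_cast h4

/-- The number of hypercube edges leaving `B`. -/
noncomputable def boundary (B : Finset (Cube d)) : ℝ :=
  ∑ x, ∑ y, if hammingDist x y = 1 then sep B x y else 0

theorem sum_sep_flip_le_boundary (B : Finset (Cube d)) :
    ∑ x, ∑ i, sep B x (flip i x) ≤ boundary B := by
  refine Finset.sum_le_sum fun x _ => ?_
  rw [← Finset.sum_filter]
  rw [← Finset.sum_image (f := fun y => sep B x y) (g := fun i => flip i x) (s := Finset.univ)
    (fun i _ j _ h => flip_injective x h)]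
  refine Finset.sum_le_sum_of_subset_of_nonneg ?_ fun y _ _ => sep_nonneg B x y
  intro y hy
  obtain ⟨i, -, rfl⟩ := Finset.mem_image.mp hy
  simp [hammingDist_flip]

/-- The `±1` indicator function of `B`. -/
def chi (B : Finset (Cube d)) (x : Cube d) : ℝ := if x ∈ B then 1 else -1

/-- Pairing `x` with `flip i x`, the contributions in direction `i` cancel unless the edge between
them leaves `B`, and then total at most 2. -/
theorem sum_chi_mul_form_le (B : Finset (Cube d)) (ε : Cube d) :
    ∑ x, chi B x * form ε x ≤ 2 * boundary B := by
  have hi : ∀ i : Fin d, ∑ x, chi B x * (sgn (ε i) * sgn (x i) : ℤ) ≤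
      2 * ∑ x, sep B x (flip i x) := by
    intro i
    have h1 := sum_flip i fun x => chi B x * (sgn (ε i) * sgn (x i) : ℤ)
    have h2 := sum_flip i fun x => sep B x (flip i x)
    simp only [flip_self, sgn_not, flip_involutive i _] at h1 h2
    have h3 : ∑ x, (chi B x * (sgn (ε i) * sgn (x i) : ℤ) +
        chi B (flip i x) * (sgn (ε i) * -sgn (x i) : ℤ)) ≤
        ∑ x, 2 * (sep B x (flip i x) + sep B (flip i x) x) := by
      refine Finset.sum_le_sum fun x _ => ?_
      cases ε i <;> cases x i <;> by_cases ha : x ∈ B <;> by_cases hb : flip i x ∈ B <;>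
        norm_num [chi, sep, sgn, ha, hb]
    rw [Finset.sum_add_distrib, h1, ← Finset.mul_sum, Finset.sum_add_distrib, h2] at h3
    linarith
  calc ∑ x, chi B x * form ε x
      = ∑ i, ∑ x, chi B x * (sgn (ε i) * sgn (x i) : ℤ) := by
        rw [Finset.sum_comm]
        refine Finset.sum_congr rfl fun x _ => ?_
        rw [form, partialForm, Int.cast_sum, Finset.mul_sum]
    _ ≤ ∑ i, 2 * ∑ x, sep B x (flip i x) := Finset.sum_le_sum fun i _ => hi i
    _ = 2 * ∑ x, ∑ i, sep B x (flip i x) := by rw [← Finset.mul_sum, Finset.sum_comm]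
    _ ≤ _ := by linarith [sum_sep_flip_le_boundary B]

/-- The number of nodes in exactly one of `B` and `P`. -/
noncomputable def discrepancy (B P : Finset (Cube d)) : ℝ :=
  ∑ x, ((if x ∈ B ∧ x ∉ P then 1 else 0) + if x ∈ P ∧ x ∉ B then 1 else 0)

theorem le_boundary_add_discrepancy (ε : Cube d) {θ : ℕ} (hθ : (θ : ℝ) ≤ √d / 16)
    (B : Finset (Cube d)) :
    2 ^ d * (√d / 32) ≤ boundary B + √d * discrepancy B (halfspace ε θ) := by
  rcases Nat.eq_zero_or_pos d with rfl | hd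
  · simp [boundary]
  have hA := le_sum_abs_form ε
  have hS := sum_form_sq ε
  have hB := sum_chi_mul_form_le B ε
  have hrr : √(d : ℝ) ^ 2 = d := Real.sq_sqrt (by positivity)
  have hr0 : 0 < √(d : ℝ) := by positivity
  set r : ℝ := √d with hr
  -- Where `B` agrees with the halfspace, `chi B x * form ε x` equals the absolute value except when
  -- `0 < form ε x ≤ θ`; there `θ ≤ r / 16` makes the loss at most `r ^ 2`. Where they disagree,
  -- `(|form ε x| - 8 * r) ^ 2 ≥ 0` gives the bound.
  have key : ∀ x, 8 * r * |(form ε x : ℝ)| - r ^ 2 - (form ε x : ℝ) ^ 2 -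
      64 * r ^ 2 * ((if x ∈ B ∧ x ∉ halfspace ε θ then 1 else 0) +
        if x ∈ halfspace ε θ ∧ x ∉ B then 1 else 0) ≤ 8 * r * (chi B x * form ε x) := by
    intro x
    have hx : x ∈ halfspace ε θ ↔ (θ : ℝ) < form ε x := by
      simp only [halfspace, Finset.mem_filter, Finset.mem_univ, true_and]
      exact_mod_cast Iff.rfl
    have h0 : (0 : ℝ) ≤ θ := by positivity
    simp only [hx, chi]
    generalize (form ε x : ℝ) = l at *
    by_cases h1 : (θ : ℝ) < l <;> by_cases h2 : x ∈ B <;> simp only [h1, h2] <;> norm_num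
    · rw [abs_of_nonneg (by linarith)]; nlinarith
    · rw [abs_of_nonneg (by linarith)]; nlinarith [sq_nonneg (l - 8 * r)]
    · rcases abs_cases l with ⟨h, h'⟩ | ⟨h, h'⟩ <;> rw [h] <;>
        nlinarith [sq_nonneg (l - 8 * r), sq_nonneg (l + 8 * r)]
    · rcases abs_cases l with ⟨h, h'⟩ | ⟨h, h'⟩ <;> rw [h] <;> nlinarith
  have h1 := Finset.sum_le_sum fun x (_ : x ∈ Finset.univ) => key x
  rw [← Finset.mul_sum, Finset.sum_sub_distrib, Finset.sum_sub_distrib, Finset.sum_sub_distrib,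
    ← Finset.mul_sum, ← Finset.mul_sum, hS] at h1
  change 8 * r * _ - _ - _ - 64 * r ^ 2 * discrepancy B (halfspace ε θ) ≤ _ at h1
  simp only [Finset.sum_const, Finset.card_univ, Fintype.card_fun, Fintype.card_bool,
    Fintype.card_fin, nsmul_eq_mul, Nat.cast_pow, Nat.cast_ofNat, ← hrr] at h1
  have h2 : r * (64 * (2 ^ d * (r / 32))) ≤
      r * (64 * (boundary B + r * discrepancy B (halfspace ε θ))) := by
    have hb0 : 0 ≤ boundary B := Finset.sum_nonneg fun x _ => Finset.sum_nonneg fun y _ => by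
      split_ifs
      · exact sep_nonneg _ _ _
      · exact le_rfl
    have h3 := mul_le_mul_of_nonneg_left hA hr0.le
    have h4 := mul_le_mul_of_nonneg_left hB hr0.le
    have h5 := mul_nonneg hr0.le hb0
    nlinarith
  linarith [le_of_mul_le_mul_left h2 hr0]

/-! ### Terminal cuts of the pendant cube. -/

/-- The terminal `z_s`, as an element of the terminal set. -/
def terminal (s : Cube d) : cubeTerminals d := ⟨Sum.inr s, by simp [cubeTerminals]⟩

theorem terminal_bijective : Function.Bijective (terminal (d := d)) := by
  constructor
  · intro s t h
    exact Sum.inr_injective (congrArg Subtype.val h)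
  · rintro ⟨v, hv⟩
    obtain ⟨s, -, rfl⟩ := Finset.mem_map.mp hv
    exact ⟨s, rfl⟩

/-- The bijection between hypercube nodes and terminals. -/
noncomputable def terminalEquiv (d : ℕ) : Cube d ≃ cubeTerminals d :=
  Equiv.ofBijective terminal terminal_bijective

/-- The set of the terminals `z_s`, `s ∈ P`. -/
noncomputable def terminals (P : Finset (Cube d)) : Finset (cubeTerminals d) :=
  P.map (terminalEquiv d).toEmbedding

theorem coe_cut_terminals (H : CapGraph (cubeTerminals d)) (P : Finset (Cube d)) :
    (H.cut (terminals P) : ℝ) =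
      ∑ x, ∑ y, (H.cap (terminal x) (terminal y) : ℝ) * sep P x y := by
  rw [coe_cut, ← Equiv.sum_comp (terminalEquiv d)]
  refine Finset.sum_congr rfl fun x _ => ?_
  rw [← Equiv.sum_comp (terminalEquiv d)]
  refine Finset.sum_congr rfl fun y _ => ?_
  simp [sep, terminals, terminalEquiv]

theorem mem_extensions_terminals {A : Finset (Cube d ⊕ Cube d)} {P : Finset (Cube d)} :
    A ∈ extensions (cubeTerminals d) (terminals P) ↔ ∀ x, Sum.inr x ∈ A ↔ x ∈ P := by
  have h : (terminals P).map (Function.Embedding.subtype _) =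
      P.map (Function.Embedding.inr : Cube d ↪ Cube d ⊕ Cube d) := by
    rw [terminals, Finset.map_map]; rfl
  rw [extensions, Finset.mem_filter, h, Finset.ext_iff]
  simp [cubeTerminals]

theorem coe_cut_pendantCube {A : Finset (Cube d ⊕ Cube d)} {B P : Finset (Cube d)}
    (hB : ∀ x, Sum.inl x ∈ A ↔ x ∈ B) (hP : ∀ x, Sum.inr x ∈ A ↔ x ∈ P) :
    ((pendantCube d).cut A : ℝ) = boundary B + √d * discrepancy B P := by
  have hb : boundary B = ∑ x, ∑ y, ((if hammingDist x y = 1 then 1 else 0 : ℝ≥0) : ℝ) *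
      if x ∈ B ∧ y ∉ B then 1 else 0 :=
    Finset.sum_congr rfl fun x _ => Finset.sum_congr rfl fun y _ => by
      by_cases h : hammingDist x y = 1 <;> simp [h, sep]
  rw [coe_cut, hb]
  simp only [Fintype.sum_sum_type, pendantCube, pendantCubeCap, sep, hB, hP,
    discrepancy, Finset.sum_add_distrib, Finset.mul_sum, mul_add]
  rw [add_assoc]
  congr 1
  simp [apply_ite, ite_and]
  ring

theorem le_terminalCut_halfspace (ε : Cube d) {θ : ℕ} (hθ : (θ : ℝ) ≤ √d / 16) :
    2 ^ d * (√d / 32) ≤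
      ((pendantCube d).terminalCut (cubeTerminals d) (terminals (halfspace ε θ)) : ℝ) := by
  obtain ⟨A, hA, h⟩ := Finset.exists_mem_eq_inf'
    (extensions_nonempty (cubeTerminals d) (terminals (halfspace ε θ))) (pendantCube d).cut
  rw [terminalCut, h, coe_cut_pendantCube (B := Finset.univ.filter fun x => Sum.inl x ∈ A)
    (by simp) (mem_extensions_terminals.mp hA)]
  exact le_boundary_add_discrepancy ε hθ _

theorem terminalCut_singleton_le (s : Cube d) :
    ((pendantCube d).terminalCut (cubeTerminals d) (terminals {s}) : ℝ) ≤ √d := by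
  have h := (pendantCube d).terminalCut_le (K := cubeTerminals d) (U := terminals {s})
    (A := {Sum.inr s}) (mem_extensions_terminals.mpr (by simp))
  refine (NNReal.coe_le_coe.mpr h).trans_eq ?_
  rw [coe_cut_pendantCube (B := ∅) (P := {s}) (by simp) (by simp)]
  simp [boundary, discrepancy, sep]

/-- The subcube of all nodes whose `i`-th bit is `b`. -/
def dictator (i : Fin d) (b : Bool) : Finset (Cube d) := Finset.univ.filter fun x => x i = b

/-- Both values of `b` are needed because `sep` is directed. -/
theorem sum_sep_dictator (x y : Cube d) :
    ∑ i, ∑ b, sep (dictator i b) x y = hammingDist x y := by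
  rw [hammingDist_eq_sum, Nat.cast_sum]
  refine Finset.sum_congr rfl fun i _ => ?_
  cases hx : x i <;> cases hy : y i <;> simp [sep, dictator, hx, hy]

theorem eq_flip_of_hammingDist_eq_one {x y : Cube d} (h : hammingDist x y = 1) {i : Fin d}
    (hi : x i ≠ y i) : y = flip i x := by
  rw [hammingDist, Finset.card_eq_one] at h
  obtain ⟨j, hj⟩ := h
  have h1 : ∀ k, x k ≠ y k ↔ k = j := fun k => by
    simpa using Finset.ext_iff.mp hj k
  obtain rfl := (h1 i).mp hi
  ext k
  by_cases hk : k = i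
  · subst hk
    rw [flip_self]
    revert hi
    cases x k <;> cases y k <;> simp
  · rw [flip_ne hk]
    exact (not_not.mp fun hne => hk ((h1 k).mp hne)).symm

theorem terminalCut_dictator_le (i : Fin d) (b : Bool) :
    ((pendantCube d).terminalCut (cubeTerminals d) (terminals (dictator i b)) : ℝ) ≤ 2 ^ d := by
  have h := (pendantCube d).terminalCut_le (K := cubeTerminals d) (U := terminals (dictator i b))
    (A := (dictator i b).disjSum (dictator i b)) (mem_extensions_terminals.mpr (by simp))
  refine (NNReal.coe_le_coe.mpr h).trans ?_
  rw [coe_cut_pendantCube (B := dictator i b) (P := dictator i b) (by simp) (by simp)]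
  have h1 : ∀ x y : Cube d, (if hammingDist x y = 1 then sep (dictator i b) x y else 0) ≤
      if y = flip i x then (1 : ℝ) else 0 := by
    intro x y
    by_cases h1 : hammingDist x y = 1 <;> by_cases h2 : x ∈ dictator i b ∧ y ∉ dictator i b
    · have h3 : x i ≠ y i := by
        simp only [dictator, Finset.mem_filter, Finset.mem_univ, true_and] at h2
        rw [h2.1]; exact Ne.symm h2.2
      simp [sep, eq_flip_of_hammingDist_eq_one h1 h3]
      split_ifs <;> norm_num
    all_goals
      simp only [sep, h1, h2, if_true, if_false]
      split_ifs <;> norm_num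
  have h2 : boundary (dictator i b) ≤ 2 ^ d := by
    refine (Finset.sum_le_sum fun x _ => Finset.sum_le_sum fun y _ => h1 x y).trans ?_
    simp
  have h3 : discrepancy (dictator i b) (dictator i b) = 0 := by simp [discrepancy]
  simpa [h3] using h2

/-! ### Averaging the cuts of the sparsifier. -/

theorem sum_cap_le {H : CapGraph (cubeTerminals d)} {q : ℝ} (hq : 0 ≤ q)
    (h : (pendantCube d).quality (cubeTerminals d) H ≤ ENNReal.ofReal q) :
    ∑ x : Cube d, ∑ y, (H.cap (terminal x) (terminal y) : ℝ) * (if x ≠ y then 1 else 0) ≤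
      2 ^ d * (q * √d) := by
  calc _ = ∑ x : Cube d, (H.cut (terminals {x}) : ℝ) := by
        refine Finset.sum_congr rfl fun x _ => ?_
        symm
        rw [coe_cut_terminals, Finset.sum_eq_single x]
        · simp [sep, eq_comm]
        · intro z _ hz; simp [sep, hz]
        · simp
    _ ≤ ∑ x : Cube d, q * √d := Finset.sum_le_sum fun x _ =>
        (cut_le_of_quality_le _ _ H hq h _).trans
          (mul_le_mul_of_nonneg_left (terminalCut_singleton_le x) hq)
    _ = _ := by simp

theorem sum_cap_mul_hammingDist_le {H : CapGraph (cubeTerminals d)} {q : ℝ} (hq : 0 ≤ q)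
    (h : (pendantCube d).quality (cubeTerminals d) H ≤ ENNReal.ofReal q) :
    ∑ x : Cube d, ∑ y, (H.cap (terminal x) (terminal y) : ℝ) * hammingDist x y ≤
      2 ^ d * (2 * q * d) := by
  calc _ = ∑ i : Fin d, ∑ b, (H.cut (terminals (dictator i b)) : ℝ) := by
        simp_rw [coe_cut_terminals, ← sum_sep_dictator, Finset.mul_sum]
        simp_rw [Finset.sum_comm (s := (Finset.univ : Finset Bool)) (t := (Finset.univ : Finset (Cube d))),
          Finset.sum_comm (s := (Finset.univ : Finset (Fin d))) (t := (Finset.univ : Finset (Cube d)))]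
    _ ≤ ∑ i : Fin d, ∑ b : Bool, q * 2 ^ d :=
        Finset.sum_le_sum fun i _ => Finset.sum_le_sum fun b _ =>
        (cut_le_of_quality_le _ _ H hq h _).trans
          (mul_le_mul_of_nonneg_left (terminalCut_dictator_le i b) hq)
    _ = _ := by simp; ring

theorem sum_cut_halfspace_le (H : CapGraph (cubeTerminals d)) (m : ℕ) {τ : ℝ} (hτ : 0 < τ) :
    ∑ ε : Cube d, ∑ θ ∈ Finset.range m, (H.cut (terminals (halfspace ε θ)) : ℝ) ≤
      2 ^ d * (2 / τ * ∑ x : Cube d, ∑ y,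
          (H.cap (terminal x) (terminal y) : ℝ) * hammingDist x y +
        τ / 2 * ∑ x : Cube d, ∑ y,
          (H.cap (terminal x) (terminal y) : ℝ) * (if x ≠ y then 1 else 0)) := by
  have pair : ∀ x y : Cube d, ∑ ε : Cube d, ∑ θ ∈ Finset.range m, sep (halfspace ε θ) x y ≤
      2 ^ d * (2 / τ * hammingDist x y + τ / 2 * (if x ≠ y then 1 else 0)) := by
    intro x y
    by_cases hxy : x = y
    · subst hxy; simp [sep]
    calc _ ≤ ∑ ε : Cube d, (1 / (2 * τ) * ((form ε x : ℝ) - form ε y) ^ 2 + τ / 2) := by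
          refine Finset.sum_le_sum fun ε _ => (sum_sep_halfspace_le ε x y m).trans ?_
          rw [← sq_abs]
          generalize |(form ε x : ℝ) - form ε y| = u
          -- AM-GM replaces `|u|` by a quadratic, whose average over `ε` is exactly known.
          have : 1 / (2 * τ) * u ^ 2 + τ / 2 - u = (u - τ) ^ 2 / (2 * τ) := by
            field_simp; ring
          have : 0 ≤ (u - τ) ^ 2 / (2 * τ) := by positivity
          linarith
      _ = _ := by
          rw [Finset.sum_add_distrib, ← Finset.mul_sum, sum_form_sub_sq]
          simp [hxy]
          field_simp
          ring
  calc _ = ∑ x : Cube d, ∑ y, (H.cap (terminal x) (terminal y) : ℝ) *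
        ∑ ε : Cube d, ∑ θ ∈ Finset.range m, sep (halfspace ε θ) x y := by
        simp_rw [coe_cut_terminals, Finset.mul_sum]
        rw [Finset.sum_congr rfl fun ε _ => Finset.sum_comm, Finset.sum_comm]
        refine Finset.sum_congr rfl fun x _ => ?_
        rw [Finset.sum_congr rfl fun ε _ => Finset.sum_comm, Finset.sum_comm]
    _ ≤ ∑ x : Cube d, ∑ y, (H.cap (terminal x) (terminal y) : ℝ) *
        (2 ^ d * (2 / τ * hammingDist x y + τ / 2 * (if x ≠ y then 1 else 0))) :=
        Finset.sum_le_sum fun x _ => Finset.sum_le_sum fun y _ =>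
          mul_le_mul_of_nonneg_left (pair x y) (NNReal.coe_nonneg _)
    _ = _ := by
        simp_rw [Finset.mul_sum, ← Finset.sum_add_distrib, Finset.mul_sum]
        refine Finset.sum_congr rfl fun x _ => Finset.sum_congr rfl fun y _ => by ring

/-- Every cut-sparsifier for the pendant cube has quality at least of order `t`, if `d = t ^ 4`. -/
theorem lt_of_quality_le {H : CapGraph (cubeTerminals d)}
    (hH : (pendantCube d).IsCutSparsifier (cubeTerminals d) H) {q t : ℝ} (hq : 0 ≤ q)
    (ht : 0 < t) (htd : t ^ 4 = d)
    (h : (pendantCube d).quality (cubeTerminals d) H ≤ ENNReal.ofReal q) :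
    t / 3000 < q := by
  have hr : √(d : ℝ) = t ^ 2 := by
    rw [← htd, show t ^ 4 = (t ^ 2) ^ 2 by ring, Real.sqrt_sq (by positivity)]
  -- With the extra 1, `m` is at least `t ^ 2 / 16`, yet every threshold below `m` is still at most
  -- `√d / 16`.
  set m := ⌊t ^ 2 / 16⌋₊ + 1 with hm
  have hm' : t ^ 2 / 16 ≤ m := by
    rw [hm]; push_cast; exact (Nat.lt_floor_add_one _).le
  have lower : 2 ^ d * (m * (2 ^ d * (t ^ 2 / 32))) ≤
      ∑ ε : Cube d, ∑ θ ∈ Finset.range m, (H.cut (terminals (halfspace ε θ)) : ℝ) := by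
    calc (2 ^ d * (m * (2 ^ d * (t ^ 2 / 32))) : ℝ)
        = ∑ ε : Cube d, ∑ θ ∈ Finset.range m, (2 ^ d * (t ^ 2 / 32) : ℝ) := by simp
      _ ≤ _ := by
        refine Finset.sum_le_sum fun ε _ => Finset.sum_le_sum fun θ hθ => ?_
        have hθ' : (θ : ℝ) ≤ t ^ 2 / 16 :=
          (Nat.cast_le.mpr (Nat.lt_succ_iff.mp (Finset.mem_range.mp hθ))).trans
            (Nat.floor_le (by positivity))
        rw [← hr] at hθ' ⊢
        exact (le_terminalCut_halfspace ε hθ').trans (NNReal.coe_le_coe.mpr (hH _))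
  have upper := sum_cut_halfspace_le H m ht
  have h1 := mul_le_mul_of_nonneg_left (sum_cap_le hq h) (show 0 ≤ t / 2 by positivity)
  have h2 := mul_le_mul_of_nonneg_left (sum_cap_mul_hammingDist_le hq h)
    (show 0 ≤ 2 / t by positivity)
  rw [hr] at h1
  rw [← htd, show 2 / t * (2 ^ d * (2 * q * t ^ 4)) = 2 ^ d * (4 * q * t ^ 3) by
    field_simp; ring] at h2
  have h3 := le_of_mul_le_mul_left (lower.trans upper) (by positivity)
  have h4 : (2 ^ d * (m * (t ^ 2 / 32)) : ℝ) ≤ 2 ^ d * (9 / 2 * q * t ^ 3) := by linarith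
  have h5 := le_of_mul_le_mul_left h4 (by positivity)
  have h6 := mul_le_mul_of_nonneg_right hm' (show 0 ≤ t ^ 2 / 32 by positivity)
  have h7 : t ^ 3 * (t / 512) ≤ t ^ 3 * (9 / 2 * q) := by linarith
  have h8 := le_of_mul_le_mul_left h7 (by positivity)
  -- The estimate gives `q ≥ t / 2304`; the weaker constant 3000 makes the inequality strict.
  linarith

end PendantCube

theorem mainTheorem1 :
    ∃ c : ℝ, 0 < c ∧ ∀ (d : ℕ) (H : CapGraph (cubeTerminals d)),
      (pendantCube d).IsCutSparsifier (cubeTerminals d) H →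
        ENNReal.ofReal (c * (Real.logb 2 ((cubeTerminals d).card : ℝ)) ^ (1 / 4 : ℝ)) <
          (pendantCube d).quality (cubeTerminals d) H := by
  refine ⟨1 / 3000, by norm_num, fun d H hH => ?_⟩
  have hlog : Real.logb 2 ((cubeTerminals d).card : ℝ) = d := by
    simp [cubeTerminals, Real.logb_pow]
  rw [hlog]
  rcases Nat.eq_zero_or_pos d with rfl | hd
  · refine lt_of_lt_of_le ?_ (one_le_quality _ _ H)
    simp
  · by_contra! hcon
    have hd' : (0 : ℝ) < d := by exact_mod_cast hd
    have ht : 0 < (d : ℝ) ^ (1 / 4 : ℝ) := Real.rpow_pos_of_pos hd' _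
    have htd : ((d : ℝ) ^ (1 / 4 : ℝ)) ^ 4 = d := by
      rw [← Real.rpow_natCast, ← Real.rpow_mul hd'.le]; norm_num
    have := PendantCube.lt_of_quality_le hH (by positivity) ht htd hcon
    linarith
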